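/- **Conventions.** $\mathcal S_n$ is the set of permutations of $[n]$ ($\mathcal S_0$ has one element). In the standard cycle form of $\pi\in\mathcal S_n$ every cycle (fixed points included) is written with its smallest element first, and cycles are listed in decreasing order of their smallest elements. A valley of a word $w_1\cdots w_r$ of distinct letters is an occurrence of one of the consecutive patterns $213$ or $312$ in it. The valleys of $\pi$ are those of $\pi(1)\cdots\pi(n)$; its cyclic valleys are the valleys of the words of the cycles in its standard cycle form (no occurrence straddles two cycles). Let $\operatorname{val}(\pi)$, $\operatorname{cval}(\pi)$, $\operatorname{cyc}(\pi)$ be the numbers of valleys, cyclic valleys and cycles of $\pi$, and $$F_{213,312}(q,x,z)=\sum_{n\ge 0}\sum_{\pi\in\mathcal S_n}q^{\operatorname{cval}(\pi)}x^{\operatorname{cyc}(\pi)}z^n,\qquad G_{213,312}(q,z)=\sum_{n\ge0}\sum_{\pi\in\mathcal S_n}q^{\operatorname{val}(\pi)}z^n .$$ A bicoloured Motzkin path of length $n$ is a lattice path from $(0,0)$ to $(n,0)$ that never goes below height $0$, with steps $\mathrm N=(1,1)$, $\mathrm S=(1,-1)$ and two differently coloured steps $\mathrm E,\mathrm F$ equal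 to $(1,0)$. Steps starting at height $h$ have weights $N_h,S_h,E_h,F_h$, and the weight $w(p)$ of a path $p$ is the product of the weights of its steps; $\mathcal M_n$ is the set of these paths of length $n$. **Theorem.** 1. For all weights $N_h,S_h,E_h,F_h$ in a commutative $\mathbb Z[q,x]$-algebra such that, for all $h\ge0$, $$E_h+F_h=2h+x,\qquad N_hS_{h+1}=(h+1)(hq+x),$$ one has $F_{213,312}(q,x,z)=\sum_{n\ge0}\sum_{p\in\mathcal M_n}w(p)z^n$. 2. As formal power series in $z$ over $\mathbb Z[q,x]$ (the convergents of the continued fraction converge coefficientwise), $$F_{213,312}(q,x,z)=\cfrac{1}{1-xz-\cfrac{xz^2}{1-(2+x)z-\cfrac{2(q+x)z^2}{1-(4+x)z-\cfrac{3(2q+x)z^2}{1-(6+x)z-\cdots}}}} .$$ 3. For every $n\ge0$, the map $\Omega$ that sends a permutation of $[n+1]$ consisting of a single cycle $(1\,c_2\cdots c_{n+1})$ to the permutation of $[n]$ with one-line form $(c_2-1)\cdots(c_{n+1}-1)$ is a bijection onto $\mathcal S_n$, and $\operatorname{val}(\Omega(c))=\operatorname{cval}(c)$. Hence, for all $k$,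 the number of permutations in $\mathcal S_n$ with $k$ valleys equals the number of permutations in $\mathcal S_{n+1}$ with exactly one cycle and $k$ cyclic valleys. 4. $F_{213,312}(q,x,z)-1$ is divisible by $xz$ in $\mathbb Z[q,x][[z]]$, and $$G_{213,312}(q,z)=\left.\frac{F_{213,312}(q,x,z)-1}{xz}\right|_{x=0}.$$ -/

import Mathlib

open Polynomial

/-! ### Consecutive patterns in words -/

/-- The reduction operator `R`: in a word with distinct letters the smallest letter is replaced
by `1`, the second smallest by `2`, and so on. -/
def reduction {α : Type*} [LinearOrder α] (u : List α) : List ℕ :=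
  u.map fun a => u.countP fun b => decide (b ≤ a)

/-- The number of occurrences of the consecutive pattern `σ` (for example `[2, 1, 3]`) in the
word `w`: the number of positions of `w` at which a factor `u` with `|u| = |σ|` and
`reduction u = σ` begins. -/
def consecutiveOccurrences {α : Type*} [LinearOrder α] (σ : List ℕ) (w : List α) : ℕ :=
  w.tails.countP fun t => decide (reduction (t.take σ.length) = σ)

/-! ### Permutations of `n` letters, in one-line form and in standard cycle form -/

/-- The one-line form `π(1) π(2) ⋯ π(n)`. -/
def oneLine {n : ℕ} (π : Equiv.Perm (Fin n)) : List (Fin n) :=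
  List.ofFn π

/-- The cycle of `π` through `i`, written `(i, π i, π (π i), …)` starting from `i`; it has length
one when `i` is a fixed point. -/
noncomputable def cycleWord {n : ℕ} (π : Equiv.Perm (Fin n)) (i : Fin n) : List (Fin n) :=
  (List.range (Function.minimalPeriod π i)).map fun t => π^[t] i

/-- The letters that are the smallest ones of their cycle, in decreasing order. -/
def cycleMinima {n : ℕ} (π : Equiv.Perm (Fin n)) : List (Fin n) :=
  ((List.finRange n).filter fun i => decide (∀ j, π.SameCycle i j → i ≤ j)).reverse

/-- The standard cycle form: every cycle (fixed points included) is written with its smallest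
letter first, and the cycles are listed in decreasing order of their smallest letters. -/
noncomputable def standardCycleForm {n : ℕ} (π : Equiv.Perm (Fin n)) : List (List (Fin n)) :=
  (cycleMinima π).map (cycleWord π)

/-- The number of cycles of `π`, fixed points included. -/
noncomputable def numCycles {n : ℕ} (π : Equiv.Perm (Fin n)) : ℕ :=
  (standardCycleForm π).length

/-- The number of cyclic occurrences of the consecutive pattern `σ` in `π`. The last letter of a
cycle and the first letter of the next cycle do not count as adjacent, so that every occurrence
of a consecutive pattern lies inside one cycle of the standard cycle form. -/
noncomputable def cyclicOccurrences {n : ℕ} (σ : List ℕ) (π : Equiv.Perm (Fin n)) : ℕ :=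
  ((standardCycleForm π).map (consecutiveOccurrences σ)).sum

/-- The number of cyclic valleys: cyclic occurrences of 213 plus cyclic occurrences of 312. -/
noncomputable def cyclicValleys {n : ℕ} (π : Equiv.Perm (Fin n)) : ℕ :=
  cyclicOccurrences [2, 1, 3] π + cyclicOccurrences [3, 1, 2] π

/-- The number of (ordinary, non-cyclic) valleys: occurrences of 213 plus occurrences of 312 in
the one-line form. -/
def valleys {n : ℕ} (π : Equiv.Perm (Fin n)) : ℕ :=
  consecutiveOccurrences [2, 1, 3] (oneLine π) + consecutiveOccurrences [3, 1, 2] (oneLine π)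

/-- `f(k, m, n)`: the number of permutations of `n` letters with `m` cycles and `k` cyclic
valleys. -/
noncomputable def cyclicValleyCount (k m n : ℕ) : ℕ :=
  Nat.card {π : Equiv.Perm (Fin n) // numCycles π = m ∧ cyclicValleys π = k}

/-- `g(k, n)`: the number of permutations of `n` letters with `k` valleys. -/
noncomputable def valleyCount (k n : ℕ) : ℕ :=
  Nat.card {π : Equiv.Perm (Fin n) // valleys π = k}

/-! ### Generating functions

The coefficient ring of the power series in `z` is `ℤ[q][x]`. -/

/-- The variable `q` of `ℤ[q][x]`. -/
noncomputable def qVar : ℤ[X][X] := Polynomial.C Polynomial.X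

/-- The variable `x` of `ℤ[q][x]`. -/
noncomputable def xVar : ℤ[X][X] := Polynomial.X

/-- `F(q, x, z)`, the sum of `q ^ (cyclic valleys) * x ^ (cycles) * z ^ n` over all `n ≥ 0` and
all permutations of `n` letters, as a power series in `z` over `ℤ[q][x]`. -/
noncomputable def cyclicValleyGF : PowerSeries ℤ[X][X] :=
  PowerSeries.mk fun n => ∑ π : Equiv.Perm (Fin n), qVar ^ cyclicValleys π * xVar ^ numCycles π

/-- `G(q, z)`, the sum of `q ^ (valleys) * z ^ n` over all `n ≥ 0` and all permutations of `n`
letters, as a power series in `z` over `ℤ[q]`. -/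
noncomputable def valleyGF : PowerSeries ℤ[X] :=
  PowerSeries.mk fun n => ∑ π : Equiv.Perm (Fin n), (Polynomial.X : ℤ[X]) ^ valleys π

/-! ### Weighted bicoloured Motzkin paths -/

/-- The steps: north `(1, 1)`, south `(1, -1)`, and east `(1, 0)` in two colours. -/
inductive MotzkinStep
  | north
  | south
  | eastE
  | eastF
  deriving DecidableEq

instance : Fintype MotzkinStep where
  elems := {.north, .south, .eastE, .eastF}
  complete s := by cases s <;> decide

/-- The vertical component of a step. -/
def MotzkinStep.rise : MotzkinStep → ℤ
  | .north => 1
  | .south => -1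
  | .eastE => 0
  | .eastF => 0

/-- The height reached after the first `i` steps of `p`, starting from height `0`. -/
def pathHeight {n : ℕ} (p : Fin n → MotzkinStep) (i : ℕ) : ℤ :=
  ∑ j with j.val < i, (p j).rise

/-- `p` is the step sequence of a (bicoloured) Motzkin path of length `n`: it never goes below
height `0` and ends at height `0`. -/
def IsMotzkinPath {n : ℕ} (p : Fin n → MotzkinStep) : Prop :=
  (∀ i ≤ n, 0 ≤ pathHeight p i) ∧ pathHeight p n = 0

instance {n : ℕ} (p : Fin n → MotzkinStep) : Decidable (IsMotzkinPath p) := by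
  unfold IsMotzkinPath
  infer_instance

/-- The weight of a step that starts at height `h`. -/
def stepWeight {A : Type*} (N S E F : ℕ → A) (h : ℕ) : MotzkinStep → A
  | .north => N h
  | .south => S h
  | .eastE => E h
  | .eastF => F h

/-- The weight of a path: the product of the weights of its steps. -/
def pathWeight {A : Type*} [CommRing A] (N S E F : ℕ → A) {n : ℕ}
    (p : Fin n → MotzkinStep) : A :=
  ∏ j : Fin n, stepWeight N S E F (pathHeight p (j : ℕ)).toNat (p j)

/-- The generating function of weighted bicoloured Motzkin paths, in which `z` marks length. -/
noncomputable def motzkinGF {A : Type*} [CommRing A] (N S E F : ℕ → A) : PowerSeries A :=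
  PowerSeries.mk fun n => ∑ p : Fin n → MotzkinStep with IsMotzkinPath p, pathWeight N S E F p

/-! ### Infinite continued fractions of Jacobi type -/

/-- The finite continued fraction
`1 / (1 - a_h z - b_h z² / (1 - a_{h+1} z - b_{h+1} z² / (⋯ / (1 - a_{h+d} z))))`.
All denominators have constant term `1`, and `PowerSeries.invOfUnit _ 1` is the inverse of such a
power series. -/
noncomputable def jConvergent {A : Type*} [CommRing A] (a b : ℕ → A) : ℕ → ℕ → PowerSeries A
  | 0, h => PowerSeries.invOfUnit (1 - PowerSeries.C (a h) * PowerSeries.X) 1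
  | d + 1, h =>
      PowerSeries.invOfUnit
        (1 - PowerSeries.C (a h) * PowerSeries.X
          - PowerSeries.C (b h) * PowerSeries.X ^ 2 * jConvergent a b d (h + 1)) 1

/-- The power series `f` is the infinite continued fraction
`1 / (1 - a_0 z - b_0 z² / (1 - a_1 z - b_1 z² / (1 - a_2 z - ⋯)))`: its convergents tend to `f`
in the topology of formal power series, i.e. every coefficient is eventually that of `f`. -/
def IsJFraction {A : Type*} [CommRing A] (f : PowerSeries A) (a b : ℕ → A) : Prop :=
  ∀ k : ℕ, ∀ᶠ d in Filter.atTop,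
    PowerSeries.coeff k (jConvergent a b d 0) = PowerSeries.coeff k f

/-! Cut a word with distinct letters at its smallest letter, as `u m v`. Its valleys are those of
`u`, those of `v`, and one at `m` if both `u` and `v` are nonempty (`listValleys_append_cons`).
Hence the exponential generating function P of nonempty words, with q marking valleys, satisfies P'
= 1 + 2P + qP² (from `valleySum_succ`).

Erasing the parentheses of the standard cycle form is Foata's bijection from permutations to words:
the blocks are recovered by cutting before each left-to-right minimum
(`IsStandard.flatten_injective`). The last block is `m v`, whose leading minimum creates no valley,
so the exponential generating function Φ of permutations by cyclic valleys and cycles satisfies Φ' =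
xΦ(1 + P) (from `blockSum_succ`).

Therefore (ΦPʰ)' = hΦPʰ⁻¹ + (2h + x)ΦPʰ + (hq + x)ΦPʰ⁺¹. Taking n!/h! times the coefficient of zⁿ in
ΦPʰ turns this into the recursion of a Stieltjes tableau with a_h = 2h + x and b_h = (h + 1)(hq + x)
(`factorial_mul_coeff_eq_stieltjes`). Column 0 of the tableau sums the weights of Motzkin paths
(`prefixSum_eq`), and its ordinary generating function is the continued fraction
(`X_pow_dvd_stieltjesGF_sub`).

The word of a single cycle is 0 followed by an arbitrary word in the other letters, and dropping the
0 changes no valley; this is Ω. Putting x = 0 in (F - 1)/(xz) keeps exactly the permutations with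
one cycle, whence G. -/

/-! ### Valleys of words -/

section Words

variable {α : Type*} [LinearOrder α]

/-- The number of interior local minima of a word, by recursion on the word. -/
def listValleys : List α → ℕ
  | a :: b :: c :: l => (if b < a ∧ b < c then 1 else 0) + listValleys (b :: c :: l)
  | _ => 0

theorem consecutiveOccurrences_cons (σ : List ℕ) (a : α) (w : List α) :
    consecutiveOccurrences σ (a :: w) =
      consecutiveOccurrences σ w +
        if reduction ((a :: w).take σ.length) = σ then 1 else 0 := by
  simp [consecutiveOccurrences, List.countP_cons]

theorem reduction_length (u : List α) : (reduction u).length = u.length := by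
  simp [reduction]

theorem consecutiveOccurrences_of_length_lt (σ : List ℕ) :
    ∀ w : List α, w.length < σ.length → consecutiveOccurrences σ w = 0
  | [], h => by
    have h' : σ ≠ [] := by rintro rfl; simp at h
    simp [consecutiveOccurrences, reduction, h'.symm]
  | a :: w, h => by
    have h' : reduction ((a :: w).take σ.length) ≠ σ := by
      intro e
      have := congrArg List.length e
      rw [reduction_length, List.length_take] at this
      omega
    rw [consecutiveOccurrences_cons, if_neg h',
      consecutiveOccurrences_of_length_lt σ w (by simp at h; omega)]

theorem reduction_triple_valley {a b c : α} (hab : a ≠ b) (hac : a ≠ c) (hbc : b ≠ c) :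
    ((if reduction [a, b, c] = [2, 1, 3] then 1 else 0) +
      if reduction [a, b, c] = [3, 1, 2] then 1 else 0) =
      if b < a ∧ b < c then 1 else 0 := by
  simp only [reduction, List.map_cons, List.map_nil, List.countP_cons, List.countP_nil]
  rcases lt_or_gt_of_ne hab with h1 | h1 <;> rcases lt_or_gt_of_ne hac with h2 | h2 <;>
    rcases lt_or_gt_of_ne hbc with h3 | h3 <;>
    simp [h1, h3, h1.le, h2.le, h3.le, h1.not_ge, h2.not_ge, h3.not_ge, h1.not_gt, h3.not_gt]

theorem consecutiveOccurrences_valley :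
    ∀ w : List α, w.Nodup →
      consecutiveOccurrences [2, 1, 3] w + consecutiveOccurrences [3, 1, 2] w = listValleys w
  | [], _ => by simp [consecutiveOccurrences_of_length_lt, listValleys]
  | [_], _ => by simp [consecutiveOccurrences_of_length_lt, listValleys]
  | [_, _], _ => by simp [consecutiveOccurrences_of_length_lt, listValleys]
  | a :: b :: c :: l, h => by
    have ih := consecutiveOccurrences_valley (b :: c :: l) h.of_cons
    have h3 : a ≠ b ∧ a ≠ c ∧ b ≠ c := by simp at h; tauto
    have ht := reduction_triple_valley h3.1 h3.2.1 h3.2.2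
    rw [consecutiveOccurrences_cons _ a, consecutiveOccurrences_cons _ a, listValleys, ← ih, ← ht]
    simp only [List.length_cons, List.length_nil, List.take_succ_cons, List.take_zero, zero_add]
    omega

/-- A leading minimum has no left neighbour, and it prevents the next letter from being a local
minimum. -/
theorem listValleys_cons_of_lt {m : α} : ∀ {v : List α}, (∀ a ∈ v, m < a) →
    listValleys (m :: v) = listValleys v
  | [], _ => rfl
  | [_], _ => rfl
  | b :: c :: l, h => by
    have : ¬ b < m := (h b (by simp)).not_gt
    simp [listValleys, this]

/-- Neighbours of `m` are never valleys, being larger than `m`, so only `m` itself can add one. This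
is the source of the factor `q` in `valleySum_succ`. -/
theorem listValleys_append_cons {m : α} {v : List α} (hv : ∀ a ∈ v, m < a) :
    ∀ {u : List α}, (∀ a ∈ u, m < a) →
      listValleys (u ++ m :: v) =
        listValleys u + listValleys v + if u ≠ [] ∧ v ≠ [] then 1 else 0
  | [], _ => by simp [listValleys_cons_of_lt hv, listValleys]
  | [a], hu => by
    have ha := hu a (by simp)
    cases v with
    | nil => simp [listValleys]
    | cons b v =>
      have hb := hv b (by simp)
      simp only [List.cons_append, List.nil_append, listValleys, listValleys_cons_of_lt hv]
      simp [ha, hb, add_comm]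
  | [a, b], hu => by
    have ih := listValleys_append_cons hv (u := [b]) (fun x hx => hu x (by simp at hx; simp [hx]))
    have hb := (hu b (by simp)).not_gt
    simp only [List.cons_append, List.nil_append] at ih ⊢
    rw [listValleys, ih]
    simp [hb, listValleys]
  | a :: b :: c :: u, hu => by
    have ih := listValleys_append_cons hv (u := b :: c :: u)
      (fun x hx => hu x (List.mem_cons_of_mem _ hx))
    simp only [List.cons_append] at ih ⊢
    rw [listValleys, ih, listValleys]
    simp [add_assoc]

theorem listValleys_map {β : Type*} [LinearOrder β] {f : α → β} (hf : StrictMono f) :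
    ∀ l : List α, listValleys (l.map f) = listValleys l
  | [] => rfl
  | [_] => rfl
  | [_, _] => rfl
  | a :: b :: c :: l => by
    have ih := listValleys_map hf (b :: c :: l)
    simp only [List.map_cons] at ih ⊢
    rw [listValleys, ih, listValleys]
    simp [hf.lt_iff_lt]

/-! ### Standard sequences of blocks -/

/-- A sequence of words, each beginning with its smallest letter, such that this letter is smaller
than all letters of the preceding words. -/
inductive IsStandard : List (List α) → Prop
  | nil : IsStandard []
  | snoc {L : List (List α)} {m : α} {v : List α} (hL : IsStandard L)
      (hu : ∀ a ∈ L.flatten, m < a) (hv : ∀ a ∈ v, m < a) : IsStandard (L ++ [m :: v])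

theorem IsStandard.eq_nil_or {L : List (List α)} (h : IsStandard L) :
    L = [] ∨ ∃ L' m v, L = L' ++ [m :: v] ∧ IsStandard L' ∧ (∀ a ∈ L'.flatten, m < a) ∧
      ∀ a ∈ v, m < a := by
  cases h with
  | nil => exact Or.inl rfl
  | snoc hL hu hv => exact Or.inr ⟨_, _, _, rfl, hL, hu, hv⟩

/-- The first letter of the last block is the minimum of the whole flattened word, which fixes the
last cut; the rest follows by induction. -/
theorem IsStandard.flatten_injective {L : List (List α)} (h : IsStandard L) :
    ∀ {L' : List (List α)}, IsStandard L' → L.flatten = L'.flatten → L = L' := by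
  induction h with
  | nil =>
    intro L' h' e
    rcases h'.eq_nil_or with rfl | ⟨A, m, v, rfl, -, -, -⟩
    · rfl
    · simp at e
  | @snoc L m v hL hu hv ih =>
    intro L' h' e
    rcases h'.eq_nil_or with rfl | ⟨A, m', v', rfl, hA, hu', hv'⟩
    · simp at e
    · have e' : L.flatten ++ m :: v = A.flatten ++ m' :: v' := by simpa using e
      have hm : m = m' := by
        apply le_antisymm
        · have : m' ∈ L.flatten ++ m :: v := by simp [e']
          rcases List.mem_append.1 this with h | h
          · exact (hu _ h).le
          · rcases List.mem_cons.1 h with h | h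
            · exact h.ge
            · exact (hv _ h).le
        · have : m ∈ A.flatten ++ m' :: v' := by simp [← e']
          rcases List.mem_append.1 this with h | h
          · exact (hu' _ h).le
          · rcases List.mem_cons.1 h with h | h
            · exact h.ge
            · exact (hv' _ h).le
      subst hm
      have h1 : m ∉ L.flatten := fun h => lt_irrefl _ (hu m h)
      have h3 : m ∉ v := fun h => lt_irrefl _ (hv m h)
      obtain ⟨h5, -, h6⟩ := (List.append_cons_inj_of_notMem h1 h3).1 e'
      rw [ih hA h5, h6]

theorem exists_append_cons_of_ne_nil {l : List α} (hl : l.Nodup) (h : l ≠ []) :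
    ∃ u m v, l = u ++ m :: v ∧ (∀ a ∈ u, m < a) ∧ ∀ a ∈ v, m < a := by
  have hne : l.toFinset.Nonempty := by simpa [List.toFinset_nonempty_iff] using h
  have hm : l.toFinset.min' hne ∈ l := List.mem_toFinset.1 (Finset.min'_mem _ _)
  obtain ⟨u, v, e⟩ := List.append_of_mem hm
  have hle : ∀ a ∈ l, l.toFinset.min' hne ≤ a := fun a ha =>
    Finset.min'_le _ _ (List.mem_toFinset.2 ha)
  generalize l.toFinset.min' hne = m at *
  subst e
  have hnd := List.nodup_middle.1 hl
  have hnm : m ∉ u ++ v := (List.nodup_cons.1 hnd).1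
  refine ⟨u, m, v, rfl, fun a ha => lt_of_le_of_ne (hle a (by simp [ha])) ?_,
    fun a ha => lt_of_le_of_ne (hle a (by simp [ha])) ?_⟩
  · rintro rfl; exact hnm (by simp [ha])
  · rintro rfl; exact hnm (by simp [ha])

theorem exists_isStandard (l : List α) (hl : l.Nodup) :
    ∃ L : List (List α), IsStandard L ∧ L.flatten = l := by
  induction hn : l.length using Nat.strong_induction_on generalizing l with
  | _ n ih =>
    by_cases h : l = []
    · exact ⟨[], .nil, by simp [h]⟩
    · obtain ⟨u, m, v, rfl, hu, hv⟩ := exists_append_cons_of_ne_nil hl h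
      obtain ⟨L, hL, rfl⟩ := ih u.length (by simp at hn; omega) u hl.of_append_left rfl
      exact ⟨_, .snoc hL hu hv, by simp⟩

open Classical in
/-- The standard sequence of blocks into which a word with distinct letters decomposes. -/
noncomputable def standardSplit (l : List α) : List (List α) :=
  if hl : l.Nodup then (exists_isStandard l hl).choose else []

theorem standardSplit_flatten {L : List (List α)} (hL : IsStandard L) (h : L.flatten.Nodup) :
    standardSplit L.flatten = L := by
  have hs := (exists_isStandard L.flatten h).choose_spec
  rw [standardSplit, dif_pos h]
  exact hs.1.flatten_injective hL hs.2

theorem standardSplit_append_cons {u v : List α} {m : α} (h : (u ++ m :: v).Nodup)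
    (hu : ∀ a ∈ u, m < a) (hv : ∀ a ∈ v, m < a) :
    standardSplit (u ++ m :: v) = standardSplit u ++ [m :: v] := by
  obtain ⟨L, hL, rfl⟩ := exists_isStandard u h.of_append_left
  have := standardSplit_flatten (IsStandard.snoc hL hu hv) (by simpa using h)
  rw [standardSplit_flatten hL h.of_append_left, ← this]
  simp

end Words

/-! ### The standard cycle form -/

section CycleForm

variable {n : ℕ}

theorem minimalPeriod_perm_pos (π : Equiv.Perm (Fin n)) (i : Fin n) :
    0 < Function.minimalPeriod π i :=
  Function.minimalPeriod_pos_of_mem_periodicPts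
    (Function.Injective.mem_periodicPts π.injective i)

theorem sameCycle_iterate (π : Equiv.Perm (Fin n)) (i : Fin n) (t : ℕ) :
    π.SameCycle i (π^[t] i) :=
  ⟨t, by rw [zpow_natCast, Equiv.Perm.iterate_eq_pow]⟩

theorem mem_cycleWord {π : Equiv.Perm (Fin n)} {i j : Fin n} :
    j ∈ cycleWord π i ↔ π.SameCycle i j := by
  constructor
  · intro h
    obtain ⟨t, -, rfl⟩ := List.mem_map.1 h
    exact sameCycle_iterate π i t
  · intro h
    obtain ⟨t, -, ht⟩ := h.exists_pow_eq'
    refine List.mem_map.2 ⟨t % Function.minimalPeriod π i,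
      List.mem_range.2 (Nat.mod_lt _ (minimalPeriod_perm_pos π i)), ?_⟩
    rw [Function.iterate_mod_minimalPeriod_eq, Equiv.Perm.iterate_eq_pow, ht]

theorem cycleWord_nodup (π : Equiv.Perm (Fin n)) (i : Fin n) : (cycleWord π i).Nodup :=
  List.Nodup.map_on (fun _ ha _ hb e => Function.iterate_injOn_Iio_minimalPeriod
    (List.mem_range.1 ha) (List.mem_range.1 hb) e) List.nodup_range

theorem cycleWord_eq_cons (π : Equiv.Perm (Fin n)) (i : Fin n) :
    ∃ v, cycleWord π i = i :: v := by
  obtain ⟨k, hk⟩ := Nat.exists_eq_succ_of_ne_zero (minimalPeriod_perm_pos π i).ne'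
  rw [cycleWord, hk, List.range_succ_eq_map]
  exact ⟨_, rfl⟩

theorem mem_cycleMinima {π : Equiv.Perm (Fin n)} {i : Fin n} :
    i ∈ cycleMinima π ↔ ∀ j, π.SameCycle i j → i ≤ j := by
  simp [cycleMinima]

theorem cycleMinima_pairwise (π : Equiv.Perm (Fin n)) : (cycleMinima π).Pairwise (· > ·) := by
  rw [cycleMinima, List.pairwise_reverse]
  exact (List.pairwise_lt_finRange n).filter _

theorem exists_mem_cycleMinima (π : Equiv.Perm (Fin n)) (i : Fin n) :
    ∃ m ∈ cycleMinima π, π.SameCycle m i := by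
  classical
  have hne : (Finset.univ.filter fun j => π.SameCycle i j).Nonempty := ⟨i, by simp [Equiv.Perm.SameCycle.refl]⟩
  obtain ⟨m, hm, hle⟩ := Finset.exists_min_image _ id hne
  have hm' : π.SameCycle i m := by simpa using hm
  exact ⟨m, mem_cycleMinima.2 fun j hj => hle j (by simpa using hm'.trans hj), hm'.symm⟩

theorem isStandard_standardCycleForm (π : Equiv.Perm (Fin n)) :
    IsStandard (standardCycleForm π) := by
  -- Generalised to any decreasing list of cycle minima, so that induction can remove the last
  -- cycle.
  have key : ∀ ms : List (Fin n), ms.Pairwise (· > ·) → (∀ m ∈ ms, m ∈ cycleMinima π) →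
      IsStandard (ms.map (cycleWord π)) := by
    intro ms
    induction ms using List.reverseRecOn with
    | nil => exact fun _ _ => .nil
    | append_singleton ms m ih =>
      intro hp hm
      obtain ⟨v, hv⟩ := cycleWord_eq_cons π m
      have hp' := List.pairwise_append.1 hp
      rw [List.map_append, List.map_singleton, hv]
      refine .snoc (ih hp'.1 fun i hi => hm i (by simp [hi])) ?_ ?_
      · intro a ha
        simp only [List.mem_flatten, List.mem_map] at ha
        obtain ⟨_, ⟨i, hi, rfl⟩, ha⟩ := ha
        exact lt_of_lt_of_le (hp'.2.2 i hi m (by simp))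
          (mem_cycleMinima.1 (hm i (by simp [hi])) a (mem_cycleWord.1 ha))
      · intro a ha
        have hnd := cycleWord_nodup π m
        rw [hv, List.nodup_cons] at hnd
        refine lt_of_le_of_ne (mem_cycleMinima.1 (hm m (by simp)) a
          (mem_cycleWord.1 (by simp [hv, ha]))) ?_
        rintro rfl
        exact hnd.1 ha
  exact key _ (cycleMinima_pairwise π) fun _ h => h

theorem mem_flatten_standardCycleForm (π : Equiv.Perm (Fin n)) (i : Fin n) :
    i ∈ (standardCycleForm π).flatten := by
  obtain ⟨m, hm, hi⟩ := exists_mem_cycleMinima π i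
  exact List.mem_flatten.2 ⟨_, List.mem_map_of_mem hm, mem_cycleWord.2 hi⟩

theorem flatten_standardCycleForm_nodup (π : Equiv.Perm (Fin n)) :
    (standardCycleForm π).flatten.Nodup := by
  rw [List.nodup_flatten, standardCycleForm]
  refine ⟨?_, ?_⟩
  · intro l hl
    obtain ⟨i, -, rfl⟩ := List.mem_map.1 hl
    exact cycleWord_nodup π i
  · rw [List.pairwise_map]
    refine (cycleMinima_pairwise π).imp_of_mem fun {a b} ha hb hab => ?_
    intro j hja hjb
    have h := (mem_cycleWord.1 hja).trans (mem_cycleWord.1 hjb).symm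
    exact hab.not_ge (mem_cycleMinima.1 ha b h)

theorem cycleWord_apply_eq {π σ : Equiv.Perm (Fin n)} {i j k : Fin n}
    (h : cycleWord π i = cycleWord σ j) (hk : k ∈ cycleWord π i) : π k = σ k := by
  obtain ⟨v, hv⟩ := cycleWord_eq_cons π i
  obtain ⟨w, hw⟩ := cycleWord_eq_cons σ j
  obtain rfl : i = j := by rw [hv, hw] at h; exact (List.cons.inj h).1
  have hp : Function.minimalPeriod π i = Function.minimalPeriod σ i := by
    simpa [cycleWord] using congrArg List.length h
  rw [cycleWord, cycleWord, hp, List.map_inj_left] at h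
  -- The endpoint `t = minimalPeriod` is included because the last letter of the word is sent back
  -- to `i`.
  have h' : ∀ t ≤ Function.minimalPeriod σ i, π^[t] i = σ^[t] i := by
    intro t ht
    rcases ht.lt_or_eq with ht | rfl
    · exact h t (List.mem_range.2 ht)
    · rw [Function.iterate_minimalPeriod, ← hp, Function.iterate_minimalPeriod]
  obtain ⟨t, ht, rfl⟩ := List.mem_map.1 hk
  rw [List.mem_range, hp] at ht
  rw [← Function.iterate_succ_apply' π, h' _ ht, h' _ ht.le, Function.iterate_succ_apply']

theorem standardCycleForm_injective :
    Function.Injective (standardCycleForm : Equiv.Perm (Fin n) → List (List (Fin n))) := by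
  intro π σ h
  ext1 i
  obtain ⟨m, hm, hi⟩ := exists_mem_cycleMinima π i
  have h1 : cycleWord π m ∈ standardCycleForm σ := h ▸ List.mem_map_of_mem hm
  obtain ⟨m', -, h2⟩ := List.mem_map.1 h1
  exact cycleWord_apply_eq h2.symm (mem_cycleWord.2 hi)

/-! ### Words with a given set of letters -/

/-- The words in which every letter of `s` occurs exactly once, and no other letter occurs. -/
noncomputable def words {α : Type*} (s : Finset α) : Finset (List α) :=
  ⟨Multiset.lists s.val, Multiset.lists_nodup_finset s⟩

theorem mem_words {α : Type*} {s : Finset α} {l : List α} :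
    l ∈ words s ↔ l.Nodup ∧ ∀ a, a ∈ l ↔ a ∈ s := by
  rw [words, Finset.mem_mk, Multiset.mem_lists_iff]
  change s.val = (l : Multiset α) ↔ _
  constructor
  · intro h
    have hn := s.nodup
    rw [h] at hn
    exact ⟨Multiset.coe_nodup.1 hn, fun a => by rw [← Finset.mem_val, h, Multiset.mem_coe]⟩
  · rintro ⟨h1, h2⟩
    exact (Multiset.Nodup.ext s.nodup (Multiset.coe_nodup.2 h1)).2 fun a => by
      simp [h2 a]

theorem oneLine_mem_words (π : Equiv.Perm (Fin n)) : oneLine π ∈ words Finset.univ :=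
  mem_words.2 ⟨List.nodup_ofFn.2 π.injective, fun a => by
    simpa [oneLine, List.mem_ofFn] using π.surjective a⟩

theorem oneLine_injective :
    Function.Injective (oneLine : Equiv.Perm (Fin n) → List (Fin n)) := fun _ _ h =>
  Equiv.coe_fn_injective (List.ofFn_injective h)

theorem exists_oneLine_eq {l : List (Fin n)} (hl : l ∈ words Finset.univ) :
    ∃ π : Equiv.Perm (Fin n), oneLine π = l := by
  obtain ⟨hnd, hmem⟩ := mem_words.1 hl
  have hlen : l.length = n := by
    rw [← List.toFinset_card_of_nodup hnd, show l.toFinset = Finset.univ by ext; simp [hmem]]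
    simp
  have hinj : Function.Injective fun i : Fin n => l.get (i.cast hlen.symm) := fun i j h =>
    Fin.cast_injective _ (hnd.injective_get h)
  refine ⟨Equiv.ofBijective _ (Finite.injective_iff_bijective.1 hinj), ?_⟩
  apply List.ext_get
  · simp [oneLine, hlen]
  · intro i h1 h2
    simp [oneLine]

theorem card_words_univ :
    (words (Finset.univ : Finset (Fin n))).card = Fintype.card (Equiv.Perm (Fin n)) := by
  classical
  rw [← Finset.card_univ]
  exact (Finset.card_nbij oneLine (fun π _ => oneLine_mem_words π) oneLine_injective.injOn
    fun l hl => by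
      obtain ⟨π, h⟩ := exists_oneLine_eq hl
      exact ⟨π, by simp, h⟩).symm

/-! ### Foata's bijection between permutations and words -/

theorem flatten_standardCycleForm_mem_words (π : Equiv.Perm (Fin n)) :
    (standardCycleForm π).flatten ∈ words Finset.univ :=
  mem_words.2 ⟨flatten_standardCycleForm_nodup π, fun i => by
    simpa using mem_flatten_standardCycleForm π i⟩

theorem flatten_standardCycleForm_injective :
    Function.Injective fun π : Equiv.Perm (Fin n) => (standardCycleForm π).flatten :=
  fun π σ h => standardCycleForm_injective
    ((isStandard_standardCycleForm π).flatten_injective (isStandard_standardCycleForm σ) h)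

/-- Surjectivity comes from counting: the map is injective and there are as many words as
permutations, so no permutation has to be built from its cycles. -/
theorem exists_flatten_standardCycleForm_eq {l : List (Fin n)} (hl : l ∈ words Finset.univ) :
    ∃ π : Equiv.Perm (Fin n), (standardCycleForm π).flatten = l := by
  have h := Finset.surjOn_of_injOn_of_card_le (s := (Finset.univ : Finset (Equiv.Perm (Fin n))))
    (t := words Finset.univ) (fun π => (standardCycleForm π).flatten)
    (fun π _ => flatten_standardCycleForm_mem_words π)
    flatten_standardCycleForm_injective.injOn (by rw [card_words_univ, Finset.card_univ])
  obtain ⟨π, -, hπ⟩ := h hl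
  exact ⟨π, hπ⟩

theorem exists_standardCycleForm_eq {L : List (List (Fin n))} (hL : IsStandard L)
    (h : L.flatten ∈ words Finset.univ) :
    ∃ π : Equiv.Perm (Fin n), standardCycleForm π = L := by
  obtain ⟨π, hπ⟩ := exists_flatten_standardCycleForm_eq h
  exact ⟨π, (isStandard_standardCycleForm π).flatten_injective hL hπ⟩

theorem valleys_eq (π : Equiv.Perm (Fin n)) : valleys π = listValleys (oneLine π) :=
  consecutiveOccurrences_valley _ (mem_words.1 (oneLine_mem_words π)).1

theorem cyclicValleys_eq (π : Equiv.Perm (Fin n)) :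
    cyclicValleys π = ((standardCycleForm π).map listValleys).sum := by
  rw [cyclicValleys, cyclicOccurrences, cyclicOccurrences, ← List.sum_map_add]
  congr 1
  refine List.map_congr_left fun l hl => consecutiveOccurrences_valley l ?_
  exact (List.nodup_flatten.1 (flatten_standardCycleForm_nodup π)).1 l hl

/-! ### Permutations consisting of a single cycle -/

theorem isStandard_singleton {α : Type*} [LinearOrder α] {m : α} {v : List α}
    (hv : ∀ a ∈ v, m < a) : IsStandard [m :: v] :=
  IsStandard.snoc .nil (by simp) hv

theorem exists_standardCycleForm_eq_singleton (σ : Equiv.Perm (Fin n)) :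
    ∃ c : Equiv.Perm (Fin (n + 1)),
      standardCycleForm c = [0 :: (oneLine σ).map Fin.succ] := by
  obtain ⟨h1, h2⟩ := mem_words.1 (oneLine_mem_words σ)
  apply exists_standardCycleForm_eq (isStandard_singleton (by simp [Fin.succ_pos]))
  rw [List.flatten_singleton]
  refine mem_words.2 ⟨List.nodup_cons.2 ⟨by simp [Fin.succ_ne_zero],
    h1.map (Fin.succ_injective n)⟩, fun a => ?_⟩
  induction a using Fin.cases with
  | zero => simp
  | succ i => simpa using (h2 i).2 (by simp)

theorem exists_oneLine_of_numCycles_eq_one {c : Equiv.Perm (Fin (n + 1))}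
    (hc : numCycles c = 1) :
    ∃ σ : Equiv.Perm (Fin n), standardCycleForm c = [0 :: (oneLine σ).map Fin.succ] := by
  obtain ⟨h1, h2⟩ := mem_words.1 (flatten_standardCycleForm_mem_words c)
  rcases (isStandard_standardCycleForm c).eq_nil_or with h | ⟨L, m, v, h, -, -, hv⟩
  · simp [numCycles, h] at hc
  · have hL : L = [] := by simpa [numCycles, h] using hc
    subst hL
    simp only [h, List.nil_append, List.flatten_singleton, List.nodup_cons] at h1 h2 ⊢
    have hm : m = 0 := by
      have h0 := (h2 0).2 (by simp)
      rcases List.mem_cons.1 h0 with e | e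
      · exact e.symm
      · exact absurd (hv 0 e) (Fin.not_lt_zero m)
    subst hm
    have hw : v.pmap (fun a ha => Fin.pred a ha) (fun a ha => (hv a ha).ne') ∈
        words (Finset.univ : Finset (Fin n)) := by
      refine mem_words.2 ⟨h1.2.pmap fun a _ b _ e => Fin.pred_inj.1 e, fun i => ?_⟩
      simp only [Finset.mem_univ, iff_true, List.mem_pmap]
      have hi := (h2 i.succ).2 (by simp)
      rcases List.mem_cons.1 hi with e | e
      · exact absurd e (Fin.succ_ne_zero i)
      · exact ⟨i.succ, e, Fin.pred_succ i⟩
    obtain ⟨σ, hσ⟩ := exists_oneLine_eq hw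
    exact ⟨σ, by rw [hσ, List.map_pmap]; simp⟩

/-- The permutation whose one-line form is obtained from the word of the only cycle by removal of
its first letter. -/
noncomputable def removeFirst (c : {c : Equiv.Perm (Fin (n + 1)) // numCycles c = 1}) :
    Equiv.Perm (Fin n) :=
  (exists_oneLine_of_numCycles_eq_one c.2).choose

theorem standardCycleForm_eq_removeFirst
    (c : {c : Equiv.Perm (Fin (n + 1)) // numCycles c = 1}) :
    standardCycleForm c.1 = [0 :: (oneLine (removeFirst c)).map Fin.succ] :=
  (exists_oneLine_of_numCycles_eq_one c.2).choose_spec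

theorem removeFirst_bijective :
    Function.Bijective (removeFirst :
      {c : Equiv.Perm (Fin (n + 1)) // numCycles c = 1} → Equiv.Perm (Fin n)) := by
  constructor
  · intro c d h
    apply Subtype.ext
    apply standardCycleForm_injective
    rw [standardCycleForm_eq_removeFirst, standardCycleForm_eq_removeFirst, h]
  · intro σ
    obtain ⟨c, hc⟩ := exists_standardCycleForm_eq_singleton σ
    refine ⟨⟨c, by simp [numCycles, hc]⟩, ?_⟩
    have h := standardCycleForm_eq_removeFirst ⟨c, by simp [numCycles, hc]⟩
    replace h := hc.symm.trans h
    simp only [List.cons.injEq, true_and, and_true] at h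
    exact oneLine_injective
      (List.map_injective_iff.2 (Fin.succ_injective n) h).symm

/-- Removal of the first letter is a bijection from permutations consisting of a single cycle onto
all permutations. -/
noncomputable def removeFirstEquiv (n : ℕ) :
    {c : Equiv.Perm (Fin (n + 1)) // numCycles c = 1} ≃ Equiv.Perm (Fin n) :=
  Equiv.ofBijective removeFirst removeFirst_bijective

theorem cyclicValleys_eq_valleys_removeFirst
    (c : {c : Equiv.Perm (Fin (n + 1)) // numCycles c = 1}) :
    cyclicValleys c.1 = valleys (removeFirst c) := by
  rw [cyclicValleys_eq, valleys_eq, standardCycleForm_eq_removeFirst, List.map_singleton,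
    List.sum_singleton, listValleys_cons_of_lt (by simp [Fin.succ_pos]),
    listValleys_map (Fin.strictMono_succ)]

end CycleForm

/-! ### Stieltjes tableaux, Motzkin paths and continued fractions -/

section Tableau

variable {A : Type*} [CommRing A]

/-- The Stieltjes tableau: the weighted number of Motzkin path prefixes of length `n` which end at
height `h`, if north steps have weight `1`, horizontal steps at height `h` have total weight `a h`,
and south steps ending at height `h` have weight `b h`. -/
def stieltjes (a b : ℕ → A) : ℕ → ℕ → A
  | 0, 0 => 1
  | 0, _ + 1 => 0
  | n + 1, 0 => a 0 * stieltjes a b n 0 + b 0 * stieltjes a b n 1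
  | n + 1, h + 1 =>
    stieltjes a b n h + a (h + 1) * stieltjes a b n (h + 1) + b (h + 1) * stieltjes a b n (h + 2)

/-- Used both to specialise to an arbitrary algebra and to descend from a fraction field. -/
theorem map_stieltjes {B : Type*} [CommRing B] (φ : A →+* B) (a b : ℕ → A) :
    ∀ n h, φ (stieltjes a b n h) = stieltjes (fun i => φ (a i)) (fun i => φ (b i)) n h
  | 0, 0 => by simp [stieltjes]
  | 0, _ + 1 => by simp [stieltjes]
  | n + 1, 0 => by simp [stieltjes, map_stieltjes φ a b n]
  | n + 1, h + 1 => by simp [stieltjes, map_stieltjes φ a b n]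

theorem stieltjes_eq_zero (a b : ℕ → A) : ∀ n h, n < h → stieltjes a b n h = 0
  | 0, _ + 1, _ => rfl
  | n + 1, h + 1, hlt => by
    rw [stieltjes, stieltjes_eq_zero a b n h (by omega),
      stieltjes_eq_zero a b n (h + 1) (by omega), stieltjes_eq_zero a b n (h + 2) (by omega)]
    ring

/-- The generating function of a column of the Stieltjes tableau. -/
noncomputable def stieltjesGF (a b : ℕ → A) (h : ℕ) : PowerSeries A :=
  PowerSeries.mk fun n => stieltjes a b n h

/-- The inhomogeneous term in the recursion of the columns of the Stieltjes tableau. -/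
noncomputable def stieltjesSource (a b : ℕ → A) : ℕ → PowerSeries A
  | 0 => 1
  | h + 1 => PowerSeries.X * stieltjesGF a b h

/-- The tableau recursion summed over `n`. It is a three-term relation between adjacent columns,
from which the continued fraction unfolds. -/
theorem stieltjesGF_eq (a b : ℕ → A) (h : ℕ) :
    (1 - PowerSeries.C (a h) * PowerSeries.X) * stieltjesGF a b h =
      stieltjesSource a b h +
        PowerSeries.C (b h) * (PowerSeries.X * stieltjesGF a b (h + 1)) := by
  rw [sub_mul, one_mul, sub_eq_iff_eq_add, mul_assoc]
  ext n
  cases h <;> cases n <;>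
    simp [stieltjesSource, stieltjesGF, stieltjes, PowerSeries.coeff_succ_X_mul,
      PowerSeries.coeff_one] <;> ring

theorem X_pow_dvd_stieltjesGF (a b : ℕ → A) (h : ℕ) :
    (PowerSeries.X : PowerSeries A) ^ h ∣ stieltjesGF a b h := by
  rw [PowerSeries.X_pow_dvd_iff]
  intro n hn
  simp [stieltjesGF, stieltjes_eq_zero a b n h hn]

theorem X_pow_dvd_sub_invOfUnit_mul {D M R : PowerSeries A} {e : ℕ}
    (hD : PowerSeries.constantCoeff D = 1) (h : PowerSeries.X ^ e ∣ D * M - R) :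
    PowerSeries.X ^ e ∣ M - PowerSeries.invOfUnit D 1 * R := by
  have h1 : D * PowerSeries.invOfUnit D 1 = 1 := PowerSeries.mul_invOfUnit D 1 (by simp [hD])
  have : M - PowerSeries.invOfUnit D 1 * R = PowerSeries.invOfUnit D 1 * (D * M - R) := by
    linear_combination (-M) * h1
  rw [this]
  exact h.mul_left _

/-- Truncating at depth 0 drops the term `b_h z` times column `h + 1`, of order at least `h + 2`.
Each further level multiplies the error at height `h + 1` by `b_h z` and a unit, which raises the
order at fixed `h` by 2. -/
theorem X_pow_dvd_stieltjesGF_sub (a b : ℕ → A) : ∀ d h,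
    (PowerSeries.X : PowerSeries A) ^ (h + 2 * d + 2) ∣
      stieltjesGF a b h - jConvergent a b d h * stieltjesSource a b h
  | 0, h => by
    rw [jConvergent]
    apply X_pow_dvd_sub_invOfUnit_mul (by simp)
    rw [stieltjesGF_eq, add_sub_cancel_left, mul_zero, add_zero, pow_succ']
    exact (mul_dvd_mul_left _ (X_pow_dvd_stieltjesGF a b (h + 1))).mul_left _
  | d + 1, h => by
    have ih := X_pow_dvd_stieltjesGF_sub a b d (h + 1)
    rw [jConvergent]
    apply X_pow_dvd_sub_invOfUnit_mul (by simp)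
    have e : (1 - PowerSeries.C (a h) * PowerSeries.X -
        PowerSeries.C (b h) * PowerSeries.X ^ 2 * jConvergent a b d (h + 1)) * stieltjesGF a b h -
        stieltjesSource a b h = PowerSeries.C (b h) * (PowerSeries.X * (stieltjesGF a b (h + 1) -
          jConvergent a b d (h + 1) * stieltjesSource a b (h + 1))) := by
      rw [sub_mul, stieltjesGF_eq, stieltjesSource]
      ring
    rw [e, show h + 2 * (d + 1) + 2 = (h + 1 + 2 * d + 2) + 1 by ring, pow_succ']
    exact (mul_dvd_mul_left _ ih).mul_left _

theorem isJFraction_stieltjesGF (a b : ℕ → A) : IsJFraction (stieltjesGF a b 0) a b := by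
  intro k
  filter_upwards [Filter.eventually_ge_atTop k] with d hd
  have h := PowerSeries.X_pow_dvd_iff.1 (X_pow_dvd_stieltjesGF_sub a b d 0) k (by omega)
  rw [stieltjesSource, mul_one, map_sub, sub_eq_zero] at h
  exact h.symm

/-! ### Motzkin path prefixes -/

/-- The step sequences which never go below height `0` and end at height `h`. -/
def IsMotzkinPrefix {n : ℕ} (h : ℤ) (p : Fin n → MotzkinStep) : Prop :=
  (∀ i ≤ n, 0 ≤ pathHeight p i) ∧ pathHeight p n = h

instance {n : ℕ} (h : ℤ) (p : Fin n → MotzkinStep) : Decidable (IsMotzkinPrefix h p) := by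
  unfold IsMotzkinPrefix
  infer_instance

theorem pathHeight_snoc_of_le {n : ℕ} (p : Fin n → MotzkinStep) (s : MotzkinStep) {i : ℕ}
    (hi : i ≤ n) :
    pathHeight (Fin.snoc p s : Fin (n + 1) → MotzkinStep) i = pathHeight p i := by
  simp only [pathHeight, Finset.sum_filter, Fin.sum_univ_castSucc]
  simp [hi]

theorem pathHeight_snoc {n : ℕ} (p : Fin n → MotzkinStep) (s : MotzkinStep) :
    pathHeight (Fin.snoc p s : Fin (n + 1) → MotzkinStep) (n + 1) = pathHeight p n + s.rise := by
  simp only [pathHeight, Finset.sum_filter, Fin.sum_univ_castSucc]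
  simp

theorem isMotzkinPrefix_snoc {n : ℕ} {h : ℤ} (hh : 0 ≤ h) (p : Fin n → MotzkinStep)
    (s : MotzkinStep) :
    IsMotzkinPrefix h (Fin.snoc p s : Fin (n + 1) → MotzkinStep) ↔
      IsMotzkinPrefix (h - s.rise) p := by
  unfold IsMotzkinPrefix
  rw [pathHeight_snoc]
  constructor
  · rintro ⟨h1, h2⟩
    refine ⟨fun i hi => ?_, by omega⟩
    rw [← pathHeight_snoc_of_le p s hi]
    exact h1 i (by omega)
  · rintro ⟨h1, h2⟩
    refine ⟨fun i hi => ?_, by omega⟩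
    rcases Nat.lt_or_ge n i with hn | hn
    · obtain rfl : i = n + 1 := by omega
      rw [pathHeight_snoc]
      omega
    · rw [pathHeight_snoc_of_le p s hn]
      exact h1 i hn

theorem pathWeight_snoc (N S E F : ℕ → A) {n : ℕ} (p : Fin n → MotzkinStep) (s : MotzkinStep) :
    pathWeight N S E F (Fin.snoc p s : Fin (n + 1) → MotzkinStep) =
      pathWeight N S E F p * stepWeight N S E F (pathHeight p n).toNat s := by
  rw [pathWeight, Fin.prod_univ_castSucc, pathWeight]
  congr 1
  · refine Finset.prod_congr rfl fun j _ => ?_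
    rw [Fin.snoc_castSucc, Fin.val_castSucc, pathHeight_snoc_of_le p s j.2.le]
  · rw [Fin.snoc_last, Fin.val_last, pathHeight_snoc_of_le p s le_rfl]

/-- The total weight of the Motzkin path prefixes of length `n` which end at height `h`. -/
def prefixSum (N S E F : ℕ → A) (n : ℕ) (h : ℤ) : A :=
  ∑ p : Fin n → MotzkinStep with IsMotzkinPrefix h p, pathWeight N S E F p

theorem prefixSum_of_neg (N S E F : ℕ → A) (n : ℕ) {h : ℤ} (hh : h < 0) :
    prefixSum N S E F n h = 0 := by
  rw [prefixSum, Finset.filter_false_of_mem, Finset.sum_empty]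
  rintro p - ⟨h1, h2⟩
  have := h1 n le_rfl
  omega

theorem prefixSum_succ (N S E F : ℕ → A) (n : ℕ) {h : ℤ} (hh : 0 ≤ h) :
    prefixSum N S E F (n + 1) h = ∑ s : MotzkinStep,
      prefixSum N S E F n (h - s.rise) * stepWeight N S E F (h - s.rise).toNat s := by
  simp only [prefixSum, Finset.sum_mul, Finset.sum_filter]
  rw [← (Fin.snocEquiv fun _ => MotzkinStep).sum_comp, Fintype.sum_prod_type]
  refine Finset.sum_congr rfl fun s _ => Finset.sum_congr rfl fun p _ => ?_
  change (if IsMotzkinPrefix h (Fin.snoc p s : Fin (n + 1) → MotzkinStep) then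
    pathWeight N S E F (Fin.snoc p s : Fin (n + 1) → MotzkinStep) else 0) = _
  simp only [isMotzkinPrefix_snoc hh]
  split_ifs with hp
  · rw [pathWeight_snoc, hp.2]
  · exact (zero_mul _).symm

theorem sum_motzkinStep {B : Type*} [AddCommMonoid B] (f : MotzkinStep → B) :
    ∑ s, f s = f .north + f .south + f .eastE + f .eastF := by
  change ∑ s ∈ ({.north, .south, .eastE, .eastF} : Finset MotzkinStep), f s = _
  simp [add_assoc]

/-- A prefix ending at height `h` has one unmatched north step from each level `i < h`, giving the
product of the `N i`; every other north step pairs with a south step. Factoring the product out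
makes division by the weights unnecessary. -/
theorem prefixSum_eq (N S E F a b : ℕ → A) (ha : ∀ h, E h + F h = a h)
    (hb : ∀ h, N h * S (h + 1) = b h) : ∀ n h : ℕ,
    prefixSum N S E F n h = (∏ i ∈ Finset.range h, N i) * stieltjes a b n h
  | 0, 0 => by simp [prefixSum, IsMotzkinPrefix, pathHeight, pathWeight, stieltjes]
  | 0, h + 1 => by
    have : ¬ (0 : ℤ) = (h : ℤ) + 1 := by omega
    simp [prefixSum, IsMotzkinPrefix, pathHeight, pathWeight, stieltjes, this]
  | n + 1, 0 => by
    have h1 := prefixSum_eq N S E F a b ha hb n 0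
    have h2 := prefixSum_eq N S E F a b ha hb n 1
    rw [prefixSum_succ _ _ _ _ _ (by simp), sum_motzkinStep]
    simp only [MotzkinStep.rise, stepWeight, stieltjes, Nat.cast_zero, Nat.cast_one] at h1 h2 ⊢
    -- A north step cannot end at height 0: it would start at height -1.
    rw [prefixSum_of_neg _ _ _ _ _ (by norm_num)]
    simp only [zero_sub, neg_neg, sub_zero, h1, h2, Int.toNat_one, Int.toNat_zero,
      Finset.prod_range_succ, Finset.prod_range_zero, ← ha, ← hb]
    ring
  | n + 1, h + 1 => by
    have h1 := prefixSum_eq N S E F a b ha hb n h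
    have h2 := prefixSum_eq N S E F a b ha hb n (h + 1)
    have h3 := prefixSum_eq N S E F a b ha hb n (h + 2)
    rw [prefixSum_succ _ _ _ _ _ (by positivity), sum_motzkinStep]
    simp only [MotzkinStep.rise, stepWeight, stieltjes]
    rw [show ((h + 1 : ℕ) : ℤ) - 1 = (h : ℕ) by push_cast; ring,
      show ((h + 1 : ℕ) : ℤ) - -1 = (h + 2 : ℕ) by push_cast; ring, sub_zero]
    simp only [h1, h2, h3, Int.toNat_natCast, Finset.prod_range_succ, ← ha, ← hb]
    ring

theorem motzkinGF_eq (N S E F a b : ℕ → A) (ha : ∀ h, E h + F h = a h)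
    (hb : ∀ h, N h * S (h + 1) = b h) : motzkinGF N S E F = stieltjesGF a b 0 := by
  ext n
  have := prefixSum_eq N S E F a b ha hb n 0
  rw [Finset.prod_range_zero, one_mul] at this
  rw [motzkinGF, stieltjesGF, PowerSeries.coeff_mk, PowerSeries.coeff_mk, ← this]
  rfl

end Tableau

/-! ### Exponential generating functions -/

section Exponential

variable {K : Type*} [Field K] [CharZero K]

/-- The exponential generating function of a sequence. -/
noncomputable def egf (a : ℕ → K) : PowerSeries K :=
  PowerSeries.mk fun n => a n / (n.factorial : K)

theorem egf_mul (a b : ℕ → K) :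
    egf a * egf b =
      egf fun n => ∑ k ∈ Finset.range (n + 1), (n.choose k : K) * (a k * b (n - k)) := by
  ext n
  rw [PowerSeries.coeff_mul, egf, egf, egf, PowerSeries.coeff_mk, Finset.sum_div,
    Finset.Nat.sum_antidiagonal_eq_sum_range_succ_mk]
  refine Finset.sum_congr rfl fun k hk => ?_
  have hk' : k ≤ n := by simpa [Nat.lt_succ_iff] using hk
  have h1 : (n.factorial : K) ≠ 0 := by exact_mod_cast n.factorial_ne_zero
  have h2 : (k.factorial : K) ≠ 0 := by exact_mod_cast k.factorial_ne_zero
  have h3 : ((n - k).factorial : K) ≠ 0 := by exact_mod_cast (n - k).factorial_ne_zero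
  rw [Nat.cast_choose K hk', PowerSeries.coeff_mk, PowerSeries.coeff_mk]
  field_simp

theorem derivative_egf (a : ℕ → K) :
    PowerSeries.derivative K (egf a) = egf fun n => a (n + 1) := by
  ext n
  have h1 : (n.factorial : K) ≠ 0 := by exact_mod_cast n.factorial_ne_zero
  have h2 : ((n : K) + 1) ≠ 0 := by exact_mod_cast n.succ_ne_zero
  rw [PowerSeries.coeff_derivative, egf, egf,
    PowerSeries.coeff_mk, PowerSeries.coeff_mk, Nat.factorial_succ]
  push_cast
  field_simp

/-- The two differential equations express the derivative of `F * P ^ h` through the powers `h - 1`,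
`h`, `h + 1` of `P`. Normalising by `h!` makes the coefficient of the lower neighbour 1 and puts the
factor `h + 1` on the upper one. -/
theorem factorial_mul_coeff_eq_stieltjes {K : Type*} [Field K] (q x : K) {F P : PowerSeries K}
    (hF0 : PowerSeries.constantCoeff F = 1) (hP0 : PowerSeries.constantCoeff P = 0)
    (hF : PowerSeries.derivative K F = PowerSeries.C x * (F * (1 + P)))
    (hP : PowerSeries.derivative K P = 1 + 2 * P + PowerSeries.C q * P ^ 2) : ∀ n h : ℕ,
    (n.factorial : K) * PowerSeries.coeff n (F * P ^ h) =
      (h.factorial : K) *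
        stieltjes (fun i => 2 * (i : K) + x) (fun i => ((i : K) + 1) * (i * q + x)) n h := by
  intro n
  induction n with
  | zero =>
    intro h
    cases h <;> simp [stieltjes, hF0, hP0]
  | succ n ih =>
    intro h
    have key : ((n + 1).factorial : K) * PowerSeries.coeff (n + 1) (F * P ^ h) =
        n.factorial * PowerSeries.coeff n (PowerSeries.derivative K (F * P ^ h)) := by
      rw [PowerSeries.coeff_derivative, Nat.factorial_succ]
      push_cast
      ring
    rw [key]
    cases h with
    | zero =>
      have e : PowerSeries.derivative K (F * P ^ 0) =
          PowerSeries.C x * (F * P ^ 0) + PowerSeries.C x * (F * P ^ 1) := by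
        rw [pow_zero, mul_one, hF]
        ring
      rw [e, map_add, PowerSeries.coeff_C_mul, PowerSeries.coeff_C_mul, stieltjes]
      have h0 := ih 0
      have h1 := ih 1
      simp only [Nat.factorial_zero, Nat.factorial_one, Nat.cast_one, Nat.cast_zero] at h0 h1 ⊢
      linear_combination x * h0 + x * h1
    | succ h =>
      have e : PowerSeries.derivative K (F * P ^ (h + 1)) =
          PowerSeries.C ((h : K) + 1) * (F * P ^ h) +
          PowerSeries.C (2 * ((h : K) + 1) + x) * (F * P ^ (h + 1)) +
          PowerSeries.C (((h : K) + 1) * q + x) * (F * P ^ (h + 2)) := by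
        rw [Derivation.leibniz, Derivation.leibniz_pow, hF, hP]
        simp only [smul_eq_mul, nsmul_eq_mul, map_add, map_mul, map_natCast, map_one, map_ofNat,
          Nat.add_sub_cancel, Nat.cast_add, Nat.cast_one]
        ring
      rw [e, map_add, map_add, PowerSeries.coeff_C_mul, PowerSeries.coeff_C_mul,
        PowerSeries.coeff_C_mul, stieltjes]
      have h0 := ih h
      have h1 := ih (h + 1)
      have h2 := ih (h + 2)
      rw [Nat.factorial_succ (h + 1), Nat.factorial_succ h] at h2
      rw [Nat.factorial_succ h] at h1 ⊢
      push_cast at h0 h1 h2 ⊢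
      linear_combination ((h : K) + 1) * h0 + (2 * ((h : K) + 1) + x) * h1 +
        (((h : K) + 1) * q + x) * h2

end Exponential

/-! ### Sums over words -/

section WordSums

variable {α β : Type*} [LinearOrder α] [LinearOrder β]

/-- The smallest letter splits a word uniquely; `T` is the set of letters to its left. -/
theorem sum_words_insert {M : Type*} [AddCommMonoid M] (f : List α → M) {m : α} {s : Finset α}
    (hm : ∀ a ∈ s, m < a) :
    ∑ l ∈ words (insert m s), f l =
      ∑ T ∈ s.powerset, ∑ p ∈ words T ×ˢ words (s \ T), f (p.1 ++ m :: p.2) := by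
  have hms : m ∉ s := fun h => lt_irrefl _ (hm m h)
  rw [Finset.sum_sigma']
  symm
  refine Finset.sum_bij (fun z _ => z.2.1 ++ m :: z.2.2) ?_ ?_ ?_ (fun _ _ => rfl)
  · rintro ⟨T, u, v⟩ h
    simp only [Finset.mem_sigma, Finset.mem_powerset, Finset.mem_product, mem_words] at h
    obtain ⟨hT, ⟨hu, hu'⟩, hv, hv'⟩ := h
    refine mem_words.2 ⟨List.nodup_middle.2 (List.nodup_cons.2 ⟨?_, ?_⟩), fun a => ?_⟩
    · simp only [List.mem_append, hu', hv', Finset.mem_sdiff]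
      rintro (h | h)
      · exact hms (hT h)
      · exact hms h.1
    · refine List.Nodup.append hu hv fun a h1 h2 => ?_
      exact (Finset.mem_sdiff.1 ((hv' a).1 h2)).2 ((hu' a).1 h1)
    · simp only [List.mem_append, List.mem_cons, hu', hv', Finset.mem_sdiff, Finset.mem_insert]
      by_cases ha : a ∈ T
      · simp [ha, hT ha]
      · simp [ha]
  · rintro ⟨T, u, v⟩ h ⟨T', u', v'⟩ h' e
    simp only [Finset.mem_sigma, Finset.mem_powerset, Finset.mem_product, mem_words] at h h' e
    have h1 : m ∉ u := fun hu => hms (h.1 ((h.2.1.2 m).1 hu))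
    have h2 : m ∉ v := fun hv => hms (Finset.mem_sdiff.1 ((h.2.2.2 m).1 hv)).1
    have h3 : m ∉ u' := fun hu => hms (h'.1 ((h'.2.1.2 m).1 hu))
    have h4 : m ∉ v' := fun hv => hms (Finset.mem_sdiff.1 ((h'.2.2.2 m).1 hv)).1
    obtain ⟨rfl, -, rfl⟩ := (List.append_cons_inj_of_notMem h3 h4).1 e.symm
    obtain rfl : T = T' := by
      ext a
      rw [← h.2.1.2, ← h'.2.1.2]
    rfl
  · intro l hl
    obtain ⟨hnd, hmem⟩ := mem_words.1 hl
    obtain ⟨u, v, rfl⟩ := List.append_of_mem ((hmem m).2 (by simp))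
    have hnd' := List.nodup_cons.1 (List.nodup_middle.1 hnd)
    have hdis := List.disjoint_of_nodup_append hnd'.2
    have hs : ∀ a, a ∈ s ↔ a ∈ u ∨ a ∈ v := by
      intro a
      have h := hmem a
      simp only [List.mem_append, List.mem_cons, Finset.mem_insert] at h hnd'
      by_cases ha : a = m
      · subst ha
        exact iff_of_false hms hnd'.1
      · simp only [ha, false_or] at h
        exact h.symm
    refine ⟨⟨u.toFinset, u, v⟩, ?_, rfl⟩
    simp only [Finset.mem_sigma, Finset.mem_powerset, Finset.mem_product, mem_words,
      Finset.mem_sdiff, List.mem_toFinset, hs]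
    refine ⟨fun a ha => (hs a).2 (Or.inl (List.mem_toFinset.1 ha)),
      ⟨hnd'.2.of_append_left, fun _ => trivial⟩, hnd'.2.of_append_right, fun a => ?_⟩
    exact ⟨fun h => ⟨Or.inr h, fun h' => hdis h' h⟩, fun h => h.1.resolve_left h.2⟩

/-- Relabelling by the increasing bijection reduces sums over words on `s` to a standard alphabet;
valleys and block decompositions see only relative order. -/
theorem sum_words_orderEmbOfFin {M : Type*} [AddCommMonoid M] (f : List α → M) {s : Finset α}
    {k : ℕ} (h : s.card = k) :
    ∑ l ∈ words s, f l = ∑ l ∈ words (Finset.univ : Finset (Fin k)),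
      f (l.map (s.orderEmbOfFin h)) := by
  symm
  have hinj : Function.Injective (s.orderEmbOfFin h) := (s.orderEmbOfFin h).injective
  have hrange : ∀ a, a ∈ s ↔ ∃ i, s.orderEmbOfFin h i = a := fun a => by
    rw [← Set.mem_range, Finset.range_orderEmbOfFin, Finset.mem_coe]
  refine Finset.sum_bij (fun l _ => l.map (s.orderEmbOfFin h)) ?_ ?_ ?_ (fun _ _ => rfl)
  · intro l hl
    obtain ⟨h1, h2⟩ := mem_words.1 hl
    refine mem_words.2 ⟨h1.map hinj, fun a => ?_⟩
    simp [hrange, h2]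
  · intro l _ l' _ e
    exact List.map_injective_iff.2 hinj e
  · intro l hl
    obtain ⟨h1, h2⟩ := mem_words.1 hl
    have : ∃ l' : List (Fin k), l'.map (s.orderEmbOfFin h) = l := by
      have : l ∈ Set.range (List.map (s.orderEmbOfFin h)) := by
        rw [Set.range_list_map]
        exact fun a ha => (hrange a).1 ((h2 a).1 ha)
      exact this
    obtain ⟨l', rfl⟩ := this
    refine ⟨l', mem_words.2 ⟨h1.of_map _, fun i => ?_⟩, rfl⟩
    have := (h2 (s.orderEmbOfFin h i)).2 ((hrange _).2 ⟨i, rfl⟩)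
    simpa [hinj.eq_iff] using this

theorem IsStandard.map {f : α → β} (hf : StrictMono f) {L : List (List α)} (hL : IsStandard L) :
    IsStandard (L.map (List.map f)) := by
  induction hL with
  | nil => exact .nil
  | @snoc L m v _ hu hv ih =>
    rw [List.map_append, List.map_singleton, List.map_cons]
    refine .snoc ih (fun a ha => ?_) fun a ha => ?_
    · rw [← List.map_flatten] at ha
      obtain ⟨b, hb, rfl⟩ := List.mem_map.1 ha
      exact hf (hu b hb)
    · obtain ⟨b, hb, rfl⟩ := List.mem_map.1 ha
      exact hf (hv b hb)

theorem standardSplit_map {f : α → β} (hf : StrictMono f) {l : List α} (hl : l.Nodup) :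
    standardSplit (l.map f) = (standardSplit l).map (List.map f) := by
  obtain ⟨L, hL, rfl⟩ := exists_isStandard l hl
  have hn := hl.map hf.injective
  rw [List.map_flatten] at hn ⊢
  rw [standardSplit_flatten hL hl, standardSplit_flatten (hL.map hf) hn]

variable {R : Type*} [CommRing R] (q x : R)

/-- The weight of a sequence of blocks: `q` for every valley of a block and `x` for every block. -/
def blockWeight (L : List (List α)) : R :=
  q ^ (L.map listValleys).sum * x ^ L.length

/-- The sum of `q ^ (valleys)` over the words with `n` letters. -/
noncomputable def valleySum (n : ℕ) : R :=
  ∑ l ∈ words (Finset.univ : Finset (Fin n)), q ^ listValleys l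

/-- The sum of the weights of the standard block decompositions of the words with `n` letters. -/
noncomputable def blockSum (n : ℕ) : R :=
  ∑ l ∈ words (Finset.univ : Finset (Fin n)), blockWeight q x (standardSplit l)

theorem sum_words_valleys (s : Finset α) :
    ∑ l ∈ words s, q ^ listValleys l = valleySum q s.card := by
  rw [sum_words_orderEmbOfFin _ rfl, valleySum]
  exact Finset.sum_congr rfl fun l _ => by rw [listValleys_map (OrderEmbedding.strictMono _)]

theorem sum_words_blockWeight (s : Finset α) :
    ∑ l ∈ words s, blockWeight q x (standardSplit l) = blockSum q x s.card := by
  rw [sum_words_orderEmbOfFin _ rfl, blockSum]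
  refine Finset.sum_congr rfl fun l hl => ?_
  have hf : StrictMono (s.orderEmbOfFin rfl) := OrderEmbedding.strictMono _
  rw [standardSplit_map hf (mem_words.1 hl).1]
  simp only [blockWeight, List.length_map, List.map_map]
  congr 3
  exact List.map_congr_left fun l _ => listValleys_map hf l

theorem words_empty {α : Type*} : words (∅ : Finset α) = {[]} := by
  ext l
  rw [mem_words, Finset.mem_singleton]
  constructor
  · rintro ⟨-, h⟩
    exact List.eq_nil_iff_forall_not_mem.2 fun a ha => by simpa using (h a).1 ha
  · rintro rfl
    simp

theorem standardSplit_nil : standardSplit ([] : List α) = [] :=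
  standardSplit_flatten (L := []) .nil (by simp)

theorem valleySum_zero : valleySum q 0 = 1 := by
  rw [valleySum, Finset.univ_eq_empty, words_empty]
  simp [listValleys]

theorem blockSum_zero : blockSum q x 0 = 1 := by
  rw [blockSum, Finset.univ_eq_empty, words_empty]
  simp [standardSplit_nil, blockWeight]

theorem mem_words_eq_nil_iff {α : Type*} {s : Finset α} {l : List α} (hl : l ∈ words s) :
    l = [] ↔ s.card = 0 := by
  rw [Finset.card_eq_zero, List.eq_nil_iff_forall_not_mem, Finset.eq_empty_iff_forall_notMem]
  exact forall_congr' fun a => not_congr ((mem_words.1 hl).2 a)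

/-! ### Recursions from the position of the smallest letter -/

theorem insert_zero_erase (n : ℕ) :
    insert 0 ((Finset.univ : Finset (Fin (n + 1))).erase 0) = Finset.univ := by
  simp

theorem zero_lt_of_mem_erase {n : ℕ} :
    ∀ a ∈ (Finset.univ : Finset (Fin (n + 1))).erase 0, 0 < a := fun _ ha =>
  Fin.pos_iff_ne_zero.2 (Finset.ne_of_mem_erase ha)

theorem sum_powerset_erase_zero (n : ℕ) (t : ℕ → ℕ → R) :
    ∑ T ∈ ((Finset.univ : Finset (Fin (n + 1))).erase 0).powerset,
      t T.card (((Finset.univ : Finset (Fin (n + 1))).erase 0) \ T).card =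
      ∑ k ∈ Finset.range (n + 1), (n.choose k : R) * t k (n - k) := by
  have hc : ((Finset.univ : Finset (Fin (n + 1))).erase 0).card = n := by simp
  have h := Finset.sum_powerset_apply_card (fun k => t k (n - k))
    (x := (Finset.univ : Finset (Fin (n + 1))).erase 0)
  rw [hc] at h
  simp only [nsmul_eq_mul] at h
  rw [← h]
  refine Finset.sum_congr rfl fun T hT => ?_
  rw [Finset.card_sdiff_of_subset (Finset.mem_powerset.1 hT), hc]

theorem valleySum_succ (n : ℕ) :
    valleySum q (n + 1) = ∑ k ∈ Finset.range (n + 1), (n.choose k : R) *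
      (valleySum q k * valleySum q (n - k) * if k ≠ 0 ∧ n - k ≠ 0 then q else 1) := by
  rw [valleySum, ← insert_zero_erase, sum_words_insert _ zero_lt_of_mem_erase,
    ← sum_powerset_erase_zero n fun i j =>
      valleySum q i * valleySum q j * if i ≠ 0 ∧ j ≠ 0 then q else 1]
  refine Finset.sum_congr rfl fun T hT => ?_
  rw [← sum_words_valleys, ← sum_words_valleys, Finset.sum_mul_sum, ← Finset.sum_product',
    Finset.sum_mul]
  refine Finset.sum_congr rfl fun p hp => ?_
  obtain ⟨h1, h2⟩ := Finset.mem_product.1 hp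
  have hu : ∀ a ∈ p.1, 0 < a := fun a ha =>
    zero_lt_of_mem_erase a (Finset.mem_powerset.1 hT (((mem_words.1 h1).2 a).1 ha))
  have hv : ∀ a ∈ p.2, 0 < a := fun a ha =>
    zero_lt_of_mem_erase a (Finset.mem_sdiff.1 (((mem_words.1 h2).2 a).1 ha)).1
  rw [listValleys_append_cons hv hu, pow_add, pow_add]
  simp only [Ne, mem_words_eq_nil_iff h1, mem_words_eq_nil_iff h2]
  split_ifs <;> simp

/-- The smallest letter opens the last block, so `p.1` keeps its own decomposition, while `0 :: p.2`
contributes one `x` and the valleys of `p.2`. -/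
theorem blockSum_succ (n : ℕ) :
    blockSum q x (n + 1) = ∑ k ∈ Finset.range (n + 1), (n.choose k : R) *
      (x * (blockSum q x k * valleySum q (n - k))) := by
  rw [blockSum, ← insert_zero_erase, sum_words_insert _ zero_lt_of_mem_erase,
    ← sum_powerset_erase_zero n fun i j => x * (blockSum q x i * valleySum q j)]
  refine Finset.sum_congr rfl fun T hT => ?_
  rw [← sum_words_valleys, ← sum_words_blockWeight, Finset.sum_mul_sum, ← Finset.sum_product',
    Finset.mul_sum]
  refine Finset.sum_congr rfl fun p hp => ?_
  obtain ⟨h1, h2⟩ := Finset.mem_product.1 hp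
  have hT' := Finset.mem_powerset.1 hT
  have hu : ∀ a ∈ p.1, 0 < a := fun a ha =>
    zero_lt_of_mem_erase a (hT' (((mem_words.1 h1).2 a).1 ha))
  have hv : ∀ a ∈ p.2, 0 < a := fun a ha =>
    zero_lt_of_mem_erase a (Finset.mem_sdiff.1 (((mem_words.1 h2).2 a).1 ha)).1
  have hnd : (p.1 ++ 0 :: p.2).Nodup := by
    refine List.nodup_middle.2 (List.nodup_cons.2 ⟨?_, ?_⟩)
    · rw [List.mem_append]
      rintro (h | h)
      · exact lt_irrefl _ (hu 0 h)
      · exact lt_irrefl _ (hv 0 h)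
    · refine List.Nodup.append (mem_words.1 h1).1 (mem_words.1 h2).1 fun a ha hb => ?_
      exact (Finset.mem_sdiff.1 (((mem_words.1 h2).2 a).1 hb)).2 (((mem_words.1 h1).2 a).1 ha)
  rw [standardSplit_append_cons hnd hu hv]
  simp only [blockWeight, List.map_append, List.map_singleton, List.sum_append,
    List.sum_singleton, List.length_append, List.length_singleton, listValleys_cons_of_lt hv]
  ring

theorem map_blockSum {S : Type*} [CommRing S] (φ : R →+* S) (n : ℕ) :
    φ (blockSum q x n) = blockSum (φ q) (φ x) n := by
  simp [blockSum, blockWeight]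

end WordSums

/-! ### The recursion of the block sums -/

section Recursion

theorem blockSum_eq_stieltjes_of_field {K : Type*} [Field K] [CharZero K] (q x : K) (n : ℕ) :
    blockSum q x n =
      stieltjes (fun i => 2 * (i : K) + x) (fun i => ((i : K) + 1) * (i * q + x)) n 0 := by
  set g := valleySum q with hg
  set f := blockSum q x with hf
  let p : ℕ → K := fun n => if n = 0 then 0 else g n
  have hg1 : egf g = 1 + egf p := by
    ext n
    cases n <;> simp [egf, p, hg, valleySum_zero, PowerSeries.coeff_one]
  have hF : PowerSeries.derivative K (egf f) = PowerSeries.C x * (egf f * (1 + egf p)) := by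
    rw [derivative_egf, ← hg1, egf_mul]
    ext n
    rw [PowerSeries.coeff_C_mul, egf, egf, PowerSeries.coeff_mk, PowerSeries.coeff_mk,
      hf, blockSum_succ, ← mul_div_assoc, Finset.mul_sum]
    congr 1
    exact Finset.sum_congr rfl fun k _ => by ring
  have hP : PowerSeries.derivative K (egf p) =
      1 + 2 * egf p + PowerSeries.C q * egf p ^ 2 := by
    -- All splittings are counted with weight 1, and those with both sides nonempty are corrected by
    -- `q - 1`.
    have e : 1 + 2 * egf p + PowerSeries.C q * egf p ^ 2 =
        egf g * egf g + PowerSeries.C (q - 1) * (egf p * egf p) := by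
      rw [hg1, map_sub, map_one]
      ring
    rw [e, derivative_egf, egf_mul, egf_mul]
    ext n
    rw [map_add, PowerSeries.coeff_C_mul, egf, egf, egf, PowerSeries.coeff_mk,
      PowerSeries.coeff_mk, PowerSeries.coeff_mk, ← mul_div_assoc, ← add_div, Finset.mul_sum,
      ← Finset.sum_add_distrib]
    congr 1
    change g (n + 1) = _
    rw [hg, valleySum_succ]
    refine Finset.sum_congr rfl fun k _ => ?_
    simp only [p]
    by_cases h1 : k = 0 <;> by_cases h2 : n - k = 0 <;> simp [h1, h2, hg]
    all_goals ring
  have h := factorial_mul_coeff_eq_stieltjes q x (F := egf f) (P := egf p)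
    (by simp [egf, hf, blockSum_zero]) (by simp [egf, p]) hF hP n 0
  have hn : (n.factorial : K) ≠ 0 := by exact_mod_cast n.factorial_ne_zero
  rw [pow_zero, mul_one, egf, PowerSeries.coeff_mk, mul_div_cancel₀ _ hn, Nat.factorial_zero,
    Nat.cast_one, one_mul] at h
  exact h

/-- Exponential generating functions divide by factorials, so the identity is proved in the fraction
field and pulled back along the injection. -/
theorem blockSum_eq_stieltjes {R : Type*} [CommRing R] [IsDomain R] [CharZero R] (q x : R)
    (n : ℕ) :
    blockSum q x n =
      stieltjes (fun i => 2 * (i : R) + x) (fun i => ((i : R) + 1) * (i * q + x)) n 0 := by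
  have : CharZero (FractionRing R) :=
    charZero_of_injective_algebraMap (IsFractionRing.injective R (FractionRing R))
  apply IsFractionRing.injective R (FractionRing R)
  rw [map_blockSum, blockSum_eq_stieltjes_of_field, map_stieltjes]
  simp only [map_add, map_mul, map_natCast, map_ofNat, map_one]

theorem sum_cyclicValleys_eq_blockSum {R : Type*} [CommRing R] (q x : R) (n : ℕ) :
    ∑ π : Equiv.Perm (Fin n), q ^ cyclicValleys π * x ^ numCycles π = blockSum q x n := by
  refine Finset.sum_bij (fun π _ => (standardCycleForm π).flatten)
    (fun π _ => flatten_standardCycleForm_mem_words π)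
    (fun π _ σ _ h => flatten_standardCycleForm_injective h) (fun l hl => ?_) fun π _ => ?_
  · obtain ⟨π, h⟩ := exists_flatten_standardCycleForm_eq hl
    exact ⟨π, Finset.mem_univ _, h⟩
  · rw [standardSplit_flatten (isStandard_standardCycleForm π)
      (flatten_standardCycleForm_nodup π), blockWeight, cyclicValleys_eq, numCycles]

theorem cyclicValleyGF_eq_stieltjesGF :
    cyclicValleyGF = stieltjesGF (fun h => 2 * (h : ℤ[X][X]) + xVar)
      (fun h => ((h : ℤ[X][X]) + 1) * ((h : ℤ[X][X]) * qVar + xVar)) 0 := by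
  ext1 n
  rw [cyclicValleyGF, stieltjesGF, PowerSeries.coeff_mk, PowerSeries.coeff_mk,
    sum_cyclicValleys_eq_blockSum, blockSum_eq_stieltjes]

end Recursion

/-! ### The quotient of the generating function -/

section Quotient

/-- Makes the truncated subtraction `numCycles π - 1` in the quotient exact. -/
theorem one_le_numCycles {n : ℕ} (π : Equiv.Perm (Fin (n + 1))) : 1 ≤ numCycles π := by
  rw [numCycles, Nat.one_le_iff_ne_zero, Ne, List.length_eq_zero_iff]
  intro h
  simpa [h] using mem_flatten_standardCycleForm π 0

/-- The power series `(F - 1) / (x z)`. -/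
noncomputable def cyclicValleyQuotient : PowerSeries ℤ[X][X] :=
  PowerSeries.mk fun n => ∑ π : Equiv.Perm (Fin (n + 1)),
    qVar ^ cyclicValleys π * xVar ^ (numCycles π - 1)

theorem cyclicValleyGF_sub_one :
    cyclicValleyGF - 1 = PowerSeries.C xVar * PowerSeries.X * cyclicValleyQuotient := by
  ext1 n
  rw [mul_assoc, PowerSeries.coeff_C_mul, map_sub, cyclicValleyGF, PowerSeries.coeff_mk,
    PowerSeries.coeff_one]
  cases n with
  | zero => rw [sum_cyclicValleys_eq_blockSum, blockSum_zero]; simp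
  | succ n =>
    rw [PowerSeries.coeff_succ_X_mul, cyclicValleyQuotient, PowerSeries.coeff_mk, Finset.mul_sum,
      if_neg n.succ_ne_zero, sub_zero]
    refine Finset.sum_congr rfl fun π _ => ?_
    rw [mul_left_comm, mul_pow_sub_one (Nat.one_le_iff_ne_zero.1 (one_le_numCycles π))]

theorem map_cyclicValleyQuotient :
    PowerSeries.map (Polynomial.evalRingHom (0 : ℤ[X])) cyclicValleyQuotient = valleyGF := by
  classical
  ext1 n
  rw [PowerSeries.coeff_map, cyclicValleyQuotient, valleyGF, PowerSeries.coeff_mk,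
    PowerSeries.coeff_mk, map_sum, ← (removeFirstEquiv n).sum_comp]
  -- At `x = 0` only the exponent 0 survives, that is, a single cycle.
  have h : ∀ π : Equiv.Perm (Fin (n + 1)), Polynomial.evalRingHom (0 : ℤ[X])
      (qVar ^ cyclicValleys π * xVar ^ (numCycles π - 1)) =
      if numCycles π = 1 then (X : ℤ[X]) ^ cyclicValleys π else 0 := by
    intro π
    have h1 := one_le_numCycles π
    by_cases h2 : numCycles π = 1
    · simp [h2, qVar]
    · simp [h2, xVar, show numCycles π - 1 ≠ 0 by omega]
  rw [Finset.sum_congr rfl fun π _ => h π, ← Finset.sum_filter,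
    Finset.sum_subtype (p := fun π => numCycles π = 1) _ (by simp)]
  exact Finset.sum_congr rfl fun c _ => by
    rw [cyclicValleys_eq_valleys_removeFirst]; rfl

theorem valleyCount_eq_cyclicValleyCount (k n : ℕ) :
    valleyCount k n = cyclicValleyCount k 1 (n + 1) := by
  rw [valleyCount, cyclicValleyCount]
  refine (Nat.card_congr ((Equiv.subtypeSubtypeEquivSubtypeInter _ _).symm.trans
    ((removeFirstEquiv n).subtypeEquiv fun c => ?_))).symm
  rw [cyclicValleys_eq_valleys_removeFirst]
  rfl

end Quotient

theorem mainTheorem3 :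
    -- `F` is the generating function of Motzkin paths, for all weights with the two properties
    (∀ (A : Type*) [CommRing A] [Algebra ℤ[X][X] A] (N S E F : ℕ → A),
      (∀ h : ℕ, E h + F h = algebraMap ℤ[X][X] A (2 * (h : ℤ[X][X]) + xVar)) →
      (∀ h : ℕ, N h * S (h + 1) =
        algebraMap ℤ[X][X] A (((h : ℤ[X][X]) + 1) * ((h : ℤ[X][X]) * qVar + xVar))) →
      PowerSeries.map (algebraMap ℤ[X][X] A) cyclicValleyGF = motzkinGF N S E F) ∧
    -- the continued fraction of `F`
    IsJFraction cyclicValleyGF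
      (fun h => 2 * (h : ℤ[X][X]) + xVar)
      (fun h => ((h : ℤ[X][X]) + 1) * ((h : ℤ[X][X]) * qVar + xVar)) ∧
    -- removing the first letter of a cycle gives a bijection that preserves the valleys
    (∀ n : ℕ, ∃ Ω : {c : Equiv.Perm (Fin (n + 1)) // numCycles c = 1} ≃ Equiv.Perm (Fin n),
      ∀ c, standardCycleForm c.1 = [0 :: (oneLine (Ω c)).map Fin.succ] ∧
        cyclicValleys c.1 = valleys (Ω c)) ∧
    (∀ k n : ℕ, valleyCount k n = cyclicValleyCount k 1 (n + 1)) ∧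
    -- `F - 1` is divisible by `x z`, and the quotient at `x = 0` is `G`
    (∃ H : PowerSeries ℤ[X][X],
      cyclicValleyGF - 1 = PowerSeries.C xVar * PowerSeries.X * H ∧
      PowerSeries.map (Polynomial.evalRingHom (0 : ℤ[X])) H = valleyGF) := by
  refine ⟨?_, ?_, fun n => ⟨removeFirstEquiv n, fun c =>
    ⟨standardCycleForm_eq_removeFirst c, cyclicValleys_eq_valleys_removeFirst c⟩⟩,
    valleyCount_eq_cyclicValleyCount,
    cyclicValleyQuotient, cyclicValleyGF_sub_one, map_cyclicValleyQuotient⟩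
  · intro A _ _ N S E F ha hb
    rw [motzkinGF_eq N S E F _ _ ha hb, cyclicValleyGF_eq_stieltjesGF]
    ext1 n
    rw [PowerSeries.coeff_map, stieltjesGF, stieltjesGF, PowerSeries.coeff_mk,
      PowerSeries.coeff_mk, map_stieltjes]
  · rw [cyclicValleyGF_eq_stieltjesGF]
    exact isJFraction_stieltjesGF _ _
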